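/- Let $A$ be an infinite-dimensional (complex, not necessarily unital) C*-algebra and let $\mathcal U$ be a non-principal ultrafilter on $\mathbb N$. Let $l^\infty(A)$ be the C*-algebra of bounded sequences in $A$ with pointwise operations and the supremum norm, let $c_{\mathcal U}(A)=\{(x_n)\in l^\infty(A):\lim_{n\to\mathcal U}\|x_n\|=0\}$, which is a closed two-sided ideal, and let $A^{\mathcal U}=l^\infty(A)/c_{\mathcal U}(A)$ be the ultrapower, a C*-algebra; write $(x_n)^{\mathcal U}$ for the class of $(x_n)$. A state is a positive linear functional of norm $1$. Then there is a state $\phi$ on $A^{\mathcal U}$ that is not a $\mathcal U$-limit of states on $A$, i.e. there is no sequence $(\psi_n)$ of states on $A$ such that $\phi\big((x_n)^{\mathcal U}\big)=\lim_{n\to\mathcal U}\psi_n(x_n)$ for all $(x_n)\in l^\infty(A)$. -/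

import Mathlib

open Filter Topology
open scoped ENNReal ComplexOrder

noncomputable section

namespace CStarUltrapower

/-- `l^∞(A)`, the C*-algebra of bounded sequences in `A` with pointwise operations and sup norm. -/
abbrev BddSeq (A : Type*) [NonUnitalCStarAlgebra A] : Type _ :=
  lp (fun _ : ℕ => A) ∞

/-- `c_U(A)`, the bounded sequences `x` in `A` with `lim_{n → U} ‖x n‖ = 0`. -/
def nullSeq (U : Ultrafilter ℕ) (A : Type*) [NonUnitalCStarAlgebra A] :
    Submodule ℂ (BddSeq A) where
  carrier := {x | Tendsto (fun n => ‖x n‖) U (𝓝 0)}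
  zero_mem' := by simp
  add_mem' := by
    intro x y hx hy
    refine squeeze_zero (fun n => norm_nonneg _) (fun n => norm_add_le (x n) (y n)) ?_
    simpa using Tendsto.add hx hy
  smul_mem' := by
    intro c x hx
    simpa [norm_smul] using Tendsto.const_mul ‖c‖ hx

/-- The ultrapower `A^U = l^∞(A) / c_U(A)`. -/
def Ultrapower (U : Ultrafilter ℕ) (A : Type*) [NonUnitalCStarAlgebra A] : Type _ :=
  BddSeq A ⧸ nullSeq U A

section Structure

variable {A : Type*} [NonUnitalCStarAlgebra A] {U : Ultrafilter ℕ}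

lemma mem_nullSeq {x : BddSeq A} :
    x ∈ nullSeq U A ↔ Tendsto (fun n => ‖x n‖) U (𝓝 0) := Iff.rfl

lemma norm_coord_le (x : BddSeq A) (n : ℕ) : ‖x n‖ ≤ ‖x‖ :=
  lp.norm_apply_le_norm ENNReal.top_ne_zero x n

lemma isClosed_nullSeq (U : Ultrafilter ℕ) (A : Type*) [NonUnitalCStarAlgebra A] :
    IsClosed (nullSeq U A : Set (BddSeq A)) := by
  refine isClosed_of_closure_subset fun x hx => ?_
  change Tendsto (fun n => ‖x n‖) U (𝓝 0)
  rw [Metric.tendsto_nhds]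
  intro ε hε
  obtain ⟨y, hy, hxy⟩ := Metric.mem_closure_iff.1 hx (ε / 2) (half_pos hε)
  have hy' : ∀ᶠ n in (U : Filter ℕ), ‖y n‖ < ε / 2 :=
    (mem_nullSeq.1 hy).eventually (gt_mem_nhds (half_pos hε))
  filter_upwards [hy'] with n hn
  have h1 : ‖x n - y n‖ ≤ ‖x - y‖ := norm_coord_le (x - y) n
  rw [dist_eq_norm] at hxy
  have h2 : ‖x n‖ ≤ ‖x n - y n‖ + ‖y n‖ := by
    simpa using norm_add_le (x n - y n) (y n)
  rw [Real.dist_eq, sub_zero, abs_of_nonneg (norm_nonneg _)]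
  linarith

instance : IsClosed (nullSeq U A : Set (BddSeq A)) := isClosed_nullSeq U A

lemma mul_sub_mul_mem {x x' y y' : BddSeq A} (hx : x - x' ∈ nullSeq U A)
    (hy : y - y' ∈ nullSeq U A) : x * y - x' * y' ∈ nullSeq U A := by
  have h : Tendsto (fun n => ‖(x - x') n‖ * ‖y‖ + ‖x'‖ * ‖(y - y') n‖) U (𝓝 0) := by
    simpa using (Tendsto.mul_const ‖y‖ hx).add (Tendsto.const_mul ‖x'‖ hy)
  refine squeeze_zero (fun n => norm_nonneg _) (fun n => ?_) h
  have e : (x * y - x' * y') n = (x - x') n * y n + x' n * (y - y') n := by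
    change x n * y n - x' n * y' n = (x n - x' n) * y n + x' n * (y n - y' n)
    noncomm_ring
  rw [e]
  refine (norm_add_le _ _).trans (add_le_add ?_ ?_)
  · exact (norm_mul_le _ _).trans
      (mul_le_mul_of_nonneg_left (norm_coord_le y n) (norm_nonneg _))
  · exact (norm_mul_le _ _).trans
      (mul_le_mul_of_nonneg_right (norm_coord_le x' n) (norm_nonneg _))

lemma star_sub_star_mem {x x' : BddSeq A} (hx : x - x' ∈ nullSeq U A) :
    star x - star x' ∈ nullSeq U A := by
  rw [← star_sub, mem_nullSeq]
  have e : (fun n => ‖(star (x - x')) n‖) = fun n => ‖(x - x') n‖ := by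
    funext n
    exact norm_star ((x - x') n)
  rw [e]
  exact hx

instance : NormedAddCommGroup (Ultrapower U A) :=
  inferInstanceAs (NormedAddCommGroup (BddSeq A ⧸ nullSeq U A))

instance : NormedSpace ℂ (Ultrapower U A) :=
  inferInstanceAs (NormedSpace ℂ (BddSeq A ⧸ nullSeq U A))

instance : CompleteSpace (Ultrapower U A) :=
  inferInstanceAs (CompleteSpace (BddSeq A ⧸ nullSeq U A))

/-- The quotient map `l^∞(A) → A^U`, sending a bounded sequence `x` to its class `(x_n)^U`. -/
def mk (U : Ultrafilter ℕ) (A : Type*) [NonUnitalCStarAlgebra A] :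
    BddSeq A →ₗ[ℂ] Ultrapower U A := (nullSeq U A).mkQ

lemma mk_surjective : Function.Surjective (mk U A : BddSeq A → Ultrapower U A) :=
  (nullSeq U A).mkQ_surjective

lemma mk_eq_mk {x y : BddSeq A} : mk U A x = mk U A y ↔ x - y ∈ nullSeq U A :=
  Submodule.Quotient.eq (nullSeq U A)

instance : Mul (Ultrapower U A) where
  mul := Quotient.map₂ (· * ·) fun _ _ hx _ _ hy =>
    (Submodule.quotientRel_def _).2 (mul_sub_mul_mem
      ((Submodule.quotientRel_def _).1 hx) ((Submodule.quotientRel_def _).1 hy))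

instance : Star (Ultrapower U A) where
  star := Quotient.map star fun _ _ hx =>
    (Submodule.quotientRel_def _).2 (star_sub_star_mem ((Submodule.quotientRel_def _).1 hx))

lemma mk_mul (x y : BddSeq A) : mk U A (x * y) = mk U A x * mk U A y := rfl

lemma mk_star (x : BddSeq A) : mk U A (star x) = star (mk U A x) := rfl

lemma norm_mk_le (x : BddSeq A) : ‖mk U A x‖ ≤ ‖x‖ :=
  Submodule.Quotient.norm_mk_le (nullSeq U A) x

/-- The norm of `(x_n)^U` is the limit of `‖x n‖` along `U`. -/
lemma tendsto_norm (x : BddSeq A) : Tendsto (fun n => ‖x n‖) U (𝓝 ‖mk U A x‖) := by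
  obtain ⟨L, -, hL⟩ := isCompact_Icc.ultrafilter_le_nhds (U.map fun n => ‖x n‖)
    (s := Set.Icc 0 ‖x‖) (by
      rw [le_principal_iff]
      change ∀ᶠ n in (U : Filter ℕ), ‖x n‖ ∈ Set.Icc 0 ‖x‖
      exact Eventually.of_forall fun n => ⟨norm_nonneg _, norm_coord_le x n⟩)
  replace hL : Tendsto (fun n => ‖x n‖) U (𝓝 L) := hL
  suffices h : ‖mk U A x‖ = L by rwa [h]
  apply le_antisymm
  · refine le_of_forall_pos_le_add fun ε hε => ?_
    have hL0 : 0 ≤ L := ge_of_tendsto' hL fun n => norm_nonneg _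
    let f : ℕ → A := fun n => if ‖x n‖ < L + ε then x n else 0
    have hf : ∀ n, ‖f n‖ ≤ L + ε := fun n => by
      by_cases h : ‖x n‖ < L + ε
      · simpa [f, h] using h.le
      · simp only [f, h, if_false, norm_zero]; linarith
    let y : BddSeq A := ⟨f, memℓp_infty ⟨L + ε, by rintro _ ⟨n, rfl⟩; exact hf n⟩⟩
    have hxy : mk U A x = mk U A y := by
      rw [mk_eq_mk, mem_nullSeq]
      refine tendsto_const_nhds.congr' ?_
      filter_upwards [hL.eventually (gt_mem_nhds (lt_add_of_pos_right L hε))] with n hn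
      have e : (x - y) n = x n - f n := rfl
      simp [e, f, hn]
    rw [hxy]
    exact (norm_mk_le y).trans (lp.norm_le_of_forall_le (by linarith) hf)
  · refine le_of_forall_pos_le_add fun ε hε => ?_
    obtain ⟨y, hy, hlt⟩ := Submodule.Quotient.norm_mk_lt (mk U A x : BddSeq A ⧸ nullSeq U A) hε
    have hxy : x - y ∈ nullSeq U A := mk_eq_mk.1 hy.symm
    refine le_trans ?_ hlt.le
    have h : Tendsto (fun n => ‖(x - y) n‖ + ‖y‖) U (𝓝 (0 + ‖y‖)) :=
      Tendsto.add_const _ hxy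
    rw [zero_add] at h
    refine le_of_tendsto_of_tendsto' hL h fun n => ?_
    have h2 : ‖x n‖ ≤ ‖x n - y n‖ + ‖y n‖ := by
      simpa using norm_add_le (x n - y n) (y n)
    exact h2.trans (by gcongr; exacts [le_rfl, norm_coord_le y n])

instance : NonUnitalNormedRing (Ultrapower U A) where
  left_distrib a b c := by
    obtain ⟨x, rfl⟩ := mk_surjective a
    obtain ⟨y, rfl⟩ := mk_surjective b
    obtain ⟨z, rfl⟩ := mk_surjective c
    simp only [← map_add, ← mk_mul, mul_add]
  right_distrib a b c := by
    obtain ⟨x, rfl⟩ := mk_surjective a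
    obtain ⟨y, rfl⟩ := mk_surjective b
    obtain ⟨z, rfl⟩ := mk_surjective c
    simp only [← map_add, ← mk_mul, add_mul]
  zero_mul a := by
    obtain ⟨x, rfl⟩ := mk_surjective a
    rw [← map_zero (mk U A), ← mk_mul, zero_mul]
  mul_zero a := by
    obtain ⟨x, rfl⟩ := mk_surjective a
    rw [← map_zero (mk U A), ← mk_mul, mul_zero]
  mul_assoc a b c := by
    obtain ⟨x, rfl⟩ := mk_surjective a
    obtain ⟨y, rfl⟩ := mk_surjective b
    obtain ⟨z, rfl⟩ := mk_surjective c
    simp only [← mk_mul, mul_assoc]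
  dist_eq := NormedAddCommGroup.dist_eq
  norm_mul_le a b := by
    obtain ⟨x, rfl⟩ := mk_surjective a
    obtain ⟨y, rfl⟩ := mk_surjective b
    rw [← mk_mul]
    exact le_of_tendsto_of_tendsto' (tendsto_norm (x * y))
      ((tendsto_norm x).mul (tendsto_norm y)) fun n => norm_mul_le (x n) (y n)

instance : StarRing (Ultrapower U A) where
  star_involutive a := by
    obtain ⟨x, rfl⟩ := mk_surjective a
    rw [← mk_star, ← mk_star, star_star]
  star_mul a b := by
    obtain ⟨x, rfl⟩ := mk_surjective a
    obtain ⟨y, rfl⟩ := mk_surjective b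
    simp only [← mk_mul, ← mk_star, star_mul]
  star_add a b := by
    obtain ⟨x, rfl⟩ := mk_surjective a
    obtain ⟨y, rfl⟩ := mk_surjective b
    simp only [← map_add, ← mk_star, star_add]

/-- The ultrapower of a C*-algebra is a C*-algebra, with the operations induced by the pointwise
ones on representing sequences, and the quotient norm. -/
instance : NonUnitalCStarAlgebra (Ultrapower U A) where
  norm_mul_self_le a := by
    obtain ⟨x, rfl⟩ := mk_surjective a
    rw [← mk_star, ← mk_mul]
    refine le_of_tendsto_of_tendsto' ((tendsto_norm x).mul (tendsto_norm x))
      (tendsto_norm (star x * x)) fun n => ?_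
    exact (CStarRing.norm_star_mul_self (x := x n)).symm.le
  smul_assoc c a b := by
    obtain ⟨x, rfl⟩ := mk_surjective a
    obtain ⟨y, rfl⟩ := mk_surjective b
    simp only [smul_eq_mul, ← map_smul, ← mk_mul, smul_mul_assoc]
  smul_comm c a b := by
    obtain ⟨x, rfl⟩ := mk_surjective a
    obtain ⟨y, rfl⟩ := mk_surjective b
    simp only [smul_eq_mul, ← map_smul, ← mk_mul, mul_smul_comm]
  star_smul c a := by
    obtain ⟨x, rfl⟩ := mk_surjective a
    simp only [← map_smul, ← mk_star, star_smul]

end Structure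

/-- A state on a (not necessarily unital) C*-algebra: a positive linear functional of norm `1`.
The positive elements of a C*-algebra are exactly those of the form `star b * b`. -/
def IsState {B : Type*} [NonUnitalCStarAlgebra B] (φ : StrongDual ℂ B) : Prop :=
  (∀ b : B, 0 ≤ φ (star b * b)) ∧ ‖φ‖ = 1

/-- `φ` is the `U`-limit of the functionals `ψ n`:
`φ ((x_n)^U) = lim_{n → U} ψ n (x n)` for every bounded sequence `x` in `A`. -/
def IsUltralimit {A : Type*} [NonUnitalCStarAlgebra A] (U : Ultrafilter ℕ)
    (ψ : ℕ → StrongDual ℂ A) (φ : StrongDual ℂ (Ultrapower U A)) : Prop :=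
  ∀ x : BddSeq A, Tendsto (fun n => ψ n (x n)) U (𝓝 (φ (mk U A x)))

end CStarUltrapower

end

/-! A `U`-limit of functionals on `A` survives diagonal arguments that an iterated limit does not.
Let `h k` be positive functionals of norm at most 1 and `P n` elements of the unit ball, with `h k
(P n)` tending to 1 as `n → ∞` and to 0 as `k → ∞`. The limit `φ` over `k` of the ultralimits of the
constant sequences `h k` is 1 at the class of `(P (N n))` whenever `N → ∞` along `U`, but 0 at every
constant sequence `P m`. If `φ` were the ultralimit of `ψ`, then for each `m` the value `ψ n (P m)`
would be small for `U`-almost all `n`, and some slowly growing `N` would keep `ψ n (P (N n))` small: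
a contradiction (`exists_isState_not_isUltralimit`).

Such data come from a self-adjoint element with infinite spectrum: evaluations at spectral points
converging to an accumulation point, against functions vanishing there and increasing to 1 at those
points (`exists_functionals_double_limit`). Without such an element, finitely many minimal
projections sum to a unit and the corners between them are at most one-dimensional, so `A` is
finite-dimensional (`finiteDimensional_of_finite_quasispectrum`). -/

namespace CStarUltrapower

/-! ### Positive functionals extending point evaluations -/

/-- On a unital C*-algebra, a functional of norm at most `1` that sends `1` to `1` is positive. -/
lemma star_mul_self_nonneg_of_map_one {B : Type*} [CStarAlgebra B] (h : StrongDual ℂ B)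
    (hn : ‖h‖ ≤ 1) (h1 : h 1 = 1) (b : B) : 0 ≤ h (star b * b) := by
  have hle (y : B) : ‖h y‖ ≤ ‖y‖ :=
    (h.le_opNorm y).trans (mul_le_of_le_one_left (norm_nonneg _) hn)
  let _ := CStarAlgebra.spectralOrder B
  have _ := CStarAlgebra.spectralOrderedRing B
  set c := star b * b with hc
  have hsa : IsSelfAdjoint c := .star_mul_self b
  have hc0 : 0 ≤ c := star_mul_self_nonneg b
  have hmap (z : ℂ) : h (algebraMap ℂ B z) = z := by
    rw [Algebra.algebraMap_eq_smul_one, map_smul, h1, smul_eq_mul, mul_one]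
  have : Nontrivial B := ⟨1, 0, fun e => by simp [e] at h1⟩
  -- Testing `h` on `c - is` gives a bound whose two sides have the same `s ^ 2` term, so the term
  -- linear in `s` forces `Im (h c) = 0`.
  have him (s : ℝ) : ((h c).im - s) ^ 2 ≤ ‖c‖ ^ 2 + s ^ 2 := by
    set d : B := c - algebraMap ℂ B (s * Complex.I) with hd
    have e : star d * d = c * c + algebraMap ℂ B (s ^ 2 : ℂ) := by
      have : star d = c + algebraMap ℂ B (s * Complex.I) := by
        rw [hd, star_sub, hsa.star_eq, ← algebraMap_star_comm]
        simp
      rw [this, hd, add_mul, mul_sub, mul_sub, ← map_mul, Algebra.commutes (s * Complex.I : ℂ) c]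
      have : (s * Complex.I * (s * Complex.I) : ℂ) = -(s ^ 2) := by
        linear_combination (s ^ 2 : ℂ) * Complex.I_sq
      rw [this, map_neg]
      abel
    have hd2 : ‖d‖ ^ 2 ≤ ‖c‖ ^ 2 + s ^ 2 := by
      rw [sq, ← CStarRing.norm_star_mul_self, e, sq ‖c‖]
      refine (norm_add_le _ _).trans (add_le_add (norm_mul_le _ _) ?_)
      rw [norm_algebraMap']
      simp
    refine le_trans ?_ hd2
    have h3 : |(h d).im| ≤ ‖d‖ := (Complex.abs_im_le_norm _).trans (hle d)
    have h4 : (h d).im = (h c).im - s := by rw [hd, map_sub, hmap]; simp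
    rw [← h4]
    exact sq_le_sq.2 (by rwa [abs_norm])
  have him0 : (h c).im = 0 := by
    by_contra hne
    -- With this `s` the cross term is `2 * ‖c‖ ^ 2`, too large for the bound.
    have := him (-(‖c‖ ^ 2 / (h c).im))
    have e : ((h c).im - -(‖c‖ ^ 2 / (h c).im)) ^ 2
        = (h c).im ^ 2 + 2 * ‖c‖ ^ 2 + (‖c‖ ^ 2 / (h c).im) ^ 2 := by
      field_simp
      ring
    rw [e] at this
    have h5 : 0 < (h c).im ^ 2 := by positivity
    nlinarith [sq_nonneg ‖c‖]
  have hre : ‖(‖c‖ : ℂ) - h c‖ ≤ ‖c‖ := by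
    have h6 : h (algebraMap ℂ B ‖c‖ - c) = ‖c‖ - h c := by rw [map_sub, hmap]
    rw [← h6]
    refine (hle _).trans ?_
    have h7 : algebraMap ℂ B ‖c‖ = algebraMap ℝ B ‖c‖ := by
      rw [IsScalarTower.algebraMap_apply ℝ ℂ B]; rfl
    rw [h7]
    have h8 : c ≤ algebraMap ℝ B ‖c‖ := hsa.le_algebraMap_norm_self
    refine (CStarAlgebra.norm_le_norm_of_nonneg_of_le (sub_nonneg.2 h8) (sub_le_self _ hc0)).trans ?_
    rw [norm_algebraMap', norm_norm]
  have h9 : ‖c‖ - (h c).re ≤ ‖c‖ := by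
    have := (Complex.re_le_norm _).trans hre
    simpa using this
  rw [Complex.nonneg_iff]
  exact ⟨by linarith, him0.symm⟩

/-- Evaluation at a point of the spectrum extends to a positive functional of norm at most `1`. -/
lemma exists_functional_cfcHom_eq {B : Type*} [CStarAlgebra B] (b : B) (hb : IsStarNormal b)
    (z : spectrum ℂ b) : ∃ h : StrongDual ℂ B, ‖h‖ ≤ 1 ∧ h 1 = 1 ∧
      ∀ g : C(spectrum ℂ b, ℂ), h (cfcHom hb g) = g z := by
  let L : C(spectrum ℂ b, ℂ) →ₗᵢ[ℂ] B :=
    { toLinearMap := (cfcHom hb : C(spectrum ℂ b, ℂ) →⋆ₐ[ℂ] B).toAlgHom.toLinearMap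
      norm_map' := fun g => norm_cfcHom b g hb }
  let ev : StrongDual ℂ C(spectrum ℂ b, ℂ) := ContinuousMap.evalCLM ℂ z
  have hL (g) : L g = cfcHom hb g := rfl
  -- Hahn–Banach: the functional calculus is isometric, so evaluation at `z` is a contraction on its
  -- range.
  obtain ⟨h, hext, hnorm⟩ := exists_extension_norm_eq L.toLinearMap.range
    (ev.comp (L.equivRange.symm.toContinuousLinearEquiv : L.toLinearMap.range →L[ℂ] _))
  have key (g) : h (cfcHom hb g) = g z := by
    have := hext (L.equivRange g)
    simpa [ev, hL] using this
  refine ⟨h, ?_, ?_, key⟩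
  · rw [hnorm]
    refine ContinuousLinearMap.opNorm_le_bound _ zero_le_one fun y => ?_
    obtain ⟨g, rfl⟩ := L.equivRange.surjective y
    simpa [ev] using g.norm_coe_le_norm z
  · simpa using key 1

/-- Evaluation at a point of the quasispectrum of a self-adjoint element extends to a positive
functional of norm at most `1`. -/
lemma exists_functional_cfcₙ_eq {A : Type*} [NonUnitalCStarAlgebra A] {a : A}
    (ha : IsSelfAdjoint a) {t : ℝ} (ht : t ∈ quasispectrum ℝ a) :
    ∃ h : StrongDual ℂ A, (∀ b, 0 ≤ h (star b * b)) ∧ ‖h‖ ≤ 1 ∧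
      ∀ f : ℝ → ℝ, Continuous f → f 0 = 0 → h (cfcₙ f a) = f t := by
  have hb : IsSelfAdjoint (a : Unitization ℂ A) := ha.inr ℂ
  rw [Unitization.quasispectrum_eq_spectrum_inr' _ ℂ] at ht
  have ht' : (t : ℂ) ∈ spectrum ℂ (a : Unitization ℂ A) := by
    simpa using spectrum.algebraMap_mem ℂ ht
  obtain ⟨h, hn, h1, hev⟩ := exists_functional_cfcHom_eq _ hb.isStarNormal ⟨_, ht'⟩
  let ι : A →L[ℂ] Unitization ℂ A :=
    (Unitization.inrNonUnitalStarAlgHom ℂ A : A →ₗ[ℂ] Unitization ℂ A).mkContinuous 1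
      fun x => by simp [Unitization.norm_inr]
  have hι (x : A) : ι x = (x : Unitization ℂ A) := rfl
  refine ⟨h.comp ι, fun b => ?_, ?_, fun f hf h0 => ?_⟩
  · simpa [hι] using star_mul_self_nonneg_of_map_one h hn h1 (b : Unitization ℂ A)
  · refine (h.opNorm_comp_le ι).trans (mul_le_one₀ hn (norm_nonneg _) ?_)
    exact LinearMap.mkContinuous_norm_le _ zero_le_one _
  · rw [ContinuousLinearMap.comp_apply, hι, Unitization.real_cfcₙ_eq_cfc_inr a f h0,
      cfc_real_eq_complex f hb, cfc_apply _ _ hb.isStarNormal (by fun_prop), hev]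
    simp

/-! ### Ultralimits and the double limit criterion -/

/-- Functionals in the unit ball converge pointwise along any ultrafilter. -/
lemma exists_tendsto_of_norm_le_one {ι E : Type*} [NormedAddCommGroup E] [NormedSpace ℂ E]
    (V : Ultrafilter ι) (g : ι → StrongDual ℂ E) (hg : ∀ i, ‖g i‖ ≤ 1) :
    ∃ φ : StrongDual ℂ E, ‖φ‖ ≤ 1 ∧ ∀ x, Tendsto (fun i => g i x) V (𝓝 (φ x)) := by
  obtain ⟨φ, hφ, hle⟩ := (WeakDual.isCompact_closedBall (0 : StrongDual ℂ E) 1).ultrafilter_le_nhds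
    (V.map fun i => StrongDual.toWeakDual (g i)) (by
      rw [le_principal_iff]
      change ∀ᶠ i in (V : Filter ι), _
      exact Eventually.of_forall fun i => by simpa using hg i)
  refine ⟨WeakDual.toStrongDual φ, by simpa using hφ, fun x => ?_⟩
  exact ((WeakDual.eval_continuous x).tendsto φ).comp hle

variable {A : Type*} [NonUnitalCStarAlgebra A] {U : Ultrafilter ℕ}

/-- Every sequence of functionals of norm at most `1` has an ultralimit on the ultrapower. -/
lemma exists_isUltralimit (U : Ultrafilter ℕ) (ψ : ℕ → StrongDual ℂ A) (hψ : ∀ n, ‖ψ n‖ ≤ 1) :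
    ∃ φ : StrongDual ℂ (Ultrapower U A), ‖φ‖ ≤ 1 ∧ IsUltralimit U ψ φ := by
  have hle (n : ℕ) (y : A) : ‖ψ n y‖ ≤ ‖y‖ :=
    ((ψ n).le_opNorm y).trans (mul_le_of_le_one_left (norm_nonneg _) (hψ n))
  let g (n : ℕ) : StrongDual ℂ (BddSeq A) :=
    ((ψ n).toLinearMap ∘ₗ lp.evalₗ (fun _ : ℕ => A) ∞ n).mkContinuous 1 fun x => by
      simpa using (hle n (x n)).trans (norm_coord_le x n)
  obtain ⟨Φ, -, hΦ⟩ := exists_tendsto_of_norm_le_one U g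
    fun n => LinearMap.mkContinuous_norm_le _ zero_le_one _
  replace hΦ (x : BddSeq A) : Tendsto (fun n => ψ n (x n)) U (𝓝 (Φ x)) := hΦ x
  -- Bounding by the quotient norm makes `Φ` vanish on null sequences.
  have hb (x : BddSeq A) : ‖Φ x‖ ≤ ‖mk U A x‖ :=
    le_of_tendsto_of_tendsto' (hΦ x).norm (tendsto_norm x) fun n => hle n (x n)
  let φ₀ : Ultrapower U A →ₗ[ℂ] ℂ := (nullSeq U A).liftQ Φ.toLinearMap fun x hx => by
    have h0 : mk U A x = 0 := (Submodule.Quotient.mk_eq_zero _).2 hx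
    have := hb x
    rw [h0, norm_zero] at this
    simpa using this
  have hφ₀ (x : BddSeq A) : φ₀ (mk U A x) = Φ x := rfl
  refine ⟨φ₀.mkContinuous 1 fun y => ?_, LinearMap.mkContinuous_norm_le _ zero_le_one _, hΦ⟩
  obtain ⟨x, rfl⟩ := mk_surjective y
  rw [hφ₀, one_mul]
  exact hb x

lemma star_mul_self_nonneg_of_isUltralimit {ψ : ℕ → StrongDual ℂ A}
    {φ : StrongDual ℂ (Ultrapower U A)} (h : IsUltralimit U ψ φ)
    (hψ : ∀ n b, 0 ≤ ψ n (star b * b)) (b : Ultrapower U A) : 0 ≤ φ (star b * b) := by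
  obtain ⟨x, rfl⟩ := mk_surjective b
  exact ge_of_tendsto' (h (star x * x)) fun n => hψ n (x n)

/-- The bounded sequence `n ↦ P n`, for `P` in the unit ball. -/
def ofUnitBall (P : ℕ → A) (hP : ∀ n, ‖P n‖ ≤ 1) : BddSeq A :=
  ⟨P, memℓp_infty ⟨1, by rintro _ ⟨n, rfl⟩; exact hP n⟩⟩

/-- If positive functionals `h k` of norm at most `1` and elements `P n` of the unit ball of `A`
violate the double limit criterion, then the iterated limit `lim_k lim_n h k (x n)` is a state on
the ultrapower that is not an ultralimit. -/
lemma exists_isState_not_isUltralimit (hU : (U : Filter ℕ) ≤ atTop) (h : ℕ → StrongDual ℂ A)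
    (hpos : ∀ k b, 0 ≤ h k (star b * b)) (hn : ∀ k, ‖h k‖ ≤ 1) (P : ℕ → A) (hP : ∀ n, ‖P n‖ ≤ 1)
    (h1 : ∀ k, Tendsto (fun n => h k (P n)) atTop (𝓝 1))
    (h0 : ∀ n, Tendsto (fun k => h k (P n)) atTop (𝓝 0)) :
    ∃ φ : StrongDual ℂ (Ultrapower U A), IsState φ ∧ ∀ ψ, ¬ IsUltralimit U ψ φ := by
  choose H hHn hH using fun k => exists_isUltralimit U (fun _ => h k) fun _ => hn k
  obtain ⟨φ, hφn, hφ⟩ := exists_tendsto_of_norm_le_one U H hHn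
  have hseq {N : ℕ → ℕ} (hN : Tendsto N U atTop) :
      φ (mk U A (ofUnitBall (fun n => P (N n)) fun n => hP _)) = 1 := by
    refine tendsto_nhds_unique (hφ _) (tendsto_const_nhds.congr fun k => ?_)
    exact tendsto_nhds_unique ((h1 k).comp hN) (hH k (ofUnitBall _ _))
  have hconst (m : ℕ) : φ (mk U A (ofUnitBall (fun _ => P m) fun _ => hP m)) = 0 := by
    refine tendsto_nhds_unique (hφ _) (((h0 m).mono_left hU).congr fun k => ?_)
    exact tendsto_nhds_unique tendsto_const_nhds (hH k (ofUnitBall _ _))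
  refine ⟨φ, ⟨fun b => ge_of_tendsto' (hφ _) fun k =>
    star_mul_self_nonneg_of_isUltralimit (hH k) (fun _ => hpos k) b, le_antisymm hφn ?_⟩, ?_⟩
  · have e := hseq (N := id) hU
    have h2 := φ.le_opNorm (mk U A (ofUnitBall (fun n => P (id n)) fun n => hP _))
    rw [e, norm_one] at h2
    refine h2.trans (mul_le_of_le_one_right (norm_nonneg _) ?_)
    exact (norm_mk_le _).trans (lp.norm_le_of_forall_le zero_le_one fun n => hP n)
  · intro ψ hψ
    classical
    -- The diagonal index. `Nat.findGreatest` returns 0 when no `m ≤ n` qualifies; `hev 0` rules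
    -- this out for `U`-almost all `n`.
    let N (n : ℕ) : ℕ := Nat.findGreatest (fun m => ‖ψ n (P m)‖ ≤ 1 / 2) n
    have hev (m : ℕ) : ∀ᶠ n in (U : Filter ℕ), ‖ψ n (P m)‖ ≤ 1 / 2 := by
      have h2 := (hψ (ofUnitBall (fun _ => P m) fun _ => hP m)).norm
      rw [hconst, norm_zero] at h2
      filter_upwards [h2.eventually (gt_mem_nhds (by norm_num : (0 : ℝ) < 1 / 2))] with n hn
      exact le_of_lt hn
    have hN : Tendsto N U atTop := tendsto_atTop.2 fun m => by
      filter_upwards [hev m, hU (eventually_ge_atTop m)] with n h3 h4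
      exact Nat.le_findGreatest h4 h3
    have hlim := (hψ (ofUnitBall (fun n => P (N n)) fun n => hP _)).norm
    rw [hseq hN, norm_one] at hlim
    have : (1 : ℝ) ≤ 1 / 2 := le_of_tendsto hlim (by
      filter_upwards [hev 0] with n h3
      exact Nat.findGreatest_spec (P := fun m => ‖ψ n (P m)‖ ≤ 1 / 2) (Nat.zero_le n) h3)
    norm_num at this

/-- A self-adjoint element with infinite spectrum yields a violation of the double limit
criterion. -/
lemma exists_functionals_double_limit {a : A} (ha : IsSelfAdjoint a)
    (hinf : (quasispectrum ℝ a).Infinite) :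
    ∃ (h : ℕ → StrongDual ℂ A) (P : ℕ → A), (∀ k b, 0 ≤ h k (star b * b)) ∧ (∀ k, ‖h k‖ ≤ 1) ∧
      (∀ n, ‖P n‖ ≤ 1) ∧ (∀ k, Tendsto (fun n => h k (P n)) atTop (𝓝 1)) ∧
      ∀ n, Tendsto (fun k => h k (P n)) atTop (𝓝 0) := by
  have hcpt : IsCompact (quasispectrum ℝ a) := quasispectrum.isCompact a
  obtain ⟨l, -, hl⟩ := hinf.exists_accPt_of_subset_isCompact hcpt le_rfl
  have hl' : ∃ᶠ t in 𝓝[≠] l, t ∈ quasispectrum ℝ a ∧ t * (t - l) ≠ 0 := by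
    have hne : ∀ᶠ t in 𝓝[≠] l, t ≠ 0 := by
      by_cases h : l = 0
      · subst h; exact self_mem_nhdsWithin
      · exact nhdsWithin_le_nhds (isOpen_ne.mem_nhds h)
    refine (accPt_iff_frequently_nhdsNE.1 hl).and_eventually ?_
    filter_upwards [hne, self_mem_nhdsWithin] with t h1 h2
    exact mul_ne_zero h1 (sub_ne_zero.2 h2)
  obtain ⟨s, hs, hsm⟩ := exists_seq_forall_of_frequently hl'
  have hs' : Tendsto s atTop (𝓝 l) := hs.mono_right nhdsWithin_le_nhds
  choose h hpos hn hev using fun k => exists_functional_cfcₙ_eq ha (hsm k).1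
  -- The factor `t` gives `f n 0 = 0`, as `cfcₙ` requires; the factor `t - l` makes `f n` vanish at
  -- the accumulation point.
  let f (n : ℕ) (t : ℝ) : ℝ := min 1 (n * |t * (t - l)|)
  have hf (n : ℕ) : Continuous (f n) := by fun_prop
  have hf0 (n : ℕ) : f n 0 = 0 := by simp [f]
  refine ⟨h, fun n => cfcₙ (f n) a, hpos, hn, fun n => ?_, fun k => ?_, fun n => ?_⟩
  · refine norm_cfcₙ_le fun t _ => ?_
    rw [Real.norm_of_nonneg (by positivity)]
    exact min_le_left _ _
  · simp only [hev k _ (hf _) (hf0 _)]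
    have hp : 0 < |s k * (s k - l)| := abs_pos.2 (hsm k).2
    have ht : Tendsto (fun n : ℕ => (n : ℝ) * |s k * (s k - l)|) atTop atTop :=
      tendsto_natCast_atTop_atTop.atTop_mul_const hp
    refine tendsto_const_nhds.congr' ?_
    filter_upwards [ht.eventually_ge_atTop 1] with n hn
    simp only [f, min_eq_left hn, Complex.ofReal_one]
  · simp only [hev _ _ (hf _) (hf0 _)]
    have ht : Tendsto (fun k => f n (s k)) atTop (𝓝 (f n l)) := ((hf n).tendsto l).comp hs'
    have hfl : f n l = 0 := by simp [f]
    rw [hfl] at ht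
    exact_mod_cast (Complex.continuous_ofReal.tendsto 0).comp ht

/-! ### Finite spectra force finite dimension -/

/-- A nonzero real eigenvalue belongs to the quasispectrum. -/
lemma mem_quasispectrum_of_mul_eq_smul {a e : A} {t : ℝ} (he : e ≠ 0)
    (h : a * e = t • e) : t ∈ quasispectrum ℝ a := by
  rw [Unitization.quasispectrum_eq_spectrum_inr' _ ℂ, spectrum.mem_iff]
  intro hu
  have h0 : (algebraMap ℝ (Unitization ℂ A) t - a) * (e : Unitization ℂ A) = 0 := by
    rw [sub_mul, ← Unitization.inr_mul, h, Algebra.algebraMap_eq_smul_one, smul_mul_assoc, one_mul,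
      Unitization.inr_smul, sub_self]
  exact he (Unitization.inr_injective (R := ℂ) (by simpa using hu.mul_right_eq_zero.1 h0))

/-- An infinite sequence of orthogonal projections yields an element of infinite spectrum. -/
lemma exists_infinite_quasispectrum_of_orthogonal {e : ℕ → A} (he : ∀ n, IsStarProjection (e n))
    (h0 : ∀ n, e n ≠ 0) (ho : ∀ m n, m ≠ n → e m * e n = 0) :
    ∃ a : A, IsSelfAdjoint a ∧ (quasispectrum ℝ a).Infinite := by
  have hs : Summable fun n : ℕ => ((1 / 2 : ℝ) ^ n) • e n := by
    refine Summable.of_norm_bounded summable_geometric_two fun n => ?_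
    rw [norm_smul, Real.norm_of_nonneg (by positivity)]
    exact mul_le_of_le_one_right (by positivity) (he n).norm_le
  refine ⟨∑' n : ℕ, ((1 / 2 : ℝ) ^ n) • e n, ?_, ?_⟩
  · rw [IsSelfAdjoint, tsum_star]
    exact tsum_congr fun n => by rw [star_smul, (he n).isSelfAdjoint.star_eq, star_trivial]
  -- The distinct weights are eigenvalues, with eigenvectors `e n`.
  · refine Set.infinite_of_injective_forall_mem (f := fun n : ℕ => (1 / 2 : ℝ) ^ n)
      (pow_right_injective₀ (by norm_num) (by norm_num)) fun n => ?_
    refine mem_quasispectrum_of_mul_eq_smul (h0 n) ?_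
    rw [← hs.tsum_mul_right,
      tsum_eq_single n fun m hm => by rw [smul_mul_assoc, ho m n hm, smul_zero], smul_mul_assoc,
      (he n).isIdempotentElem.eq]

/-- A self-adjoint element with finite spectrum is a combination of projections, each of which is
a left multiple of the element. -/
lemma exists_sum_smul_projection {a : A} (ha : IsSelfAdjoint a) (hf : (quasispectrum ℝ a).Finite) :
    ∃ (s : Finset ℝ) (q : ℝ → A), (∀ t ∈ s, IsStarProjection (q t) ∧ ∃ b, q t = b * a) ∧
      a = ∑ t ∈ s, t • q t := by
  classical
  let χ (t c x : ℝ) : ℝ := if x = t then c else 0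
  have hcont (f : ℝ → ℝ) : ContinuousOn f (quasispectrum ℝ a) := hf.continuousOn f
  have hχ0 {t : ℝ} (ht : t ≠ 0) (c : ℝ) : χ t c 0 = 0 := if_neg ht.symm
  -- Every function is continuous on a finite spectrum, so indicators of nonzero points are
  -- admissible; the left factor is the indicator divided by `t`.
  refine ⟨hf.toFinset.erase 0, fun t => cfcₙ (χ t 1) a,
    fun t ht => ⟨⟨?_, cfcₙ_predicate _ a⟩, cfcₙ (χ t t⁻¹) a, ?_⟩, ?_⟩
  · have ht0 : t ≠ 0 := Finset.ne_of_mem_erase ht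
    change cfcₙ (χ t 1) a * cfcₙ (χ t 1) a = cfcₙ (χ t 1) a
    rw [← cfcₙ_mul (χ t 1) (χ t 1) a (hcont _) (hχ0 ht0 _) (hcont _) (hχ0 ht0 _)]
    refine cfcₙ_congr fun x _ => ?_
    simp [χ]
  · have ht0 : t ≠ 0 := Finset.ne_of_mem_erase ht
    have h1 : cfcₙ (χ t t⁻¹) a * a = cfcₙ (χ t t⁻¹) a * cfcₙ (fun x : ℝ => x) a := by
      rw [cfcₙ_id' ℝ a]
    rw [h1, ← cfcₙ_mul (χ t t⁻¹) _ a (hcont _) (hχ0 ht0 _) (hcont _) rfl]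
    refine cfcₙ_congr fun x _ => ?_
    by_cases h : x = t
    · simp [χ, h, ht0]
    · simp [χ, h]
  · have h1 (t : ℝ) (ht : t ∈ hf.toFinset.erase 0) :
        t • cfcₙ (χ t 1) a = cfcₙ (fun x => t • χ t 1 x) a :=
      (cfcₙ_smul t _ a (hcont _) (hχ0 (Finset.ne_of_mem_erase ht) _)).symm
    rw [Finset.sum_congr rfl h1, ← cfcₙ_sum _ a _ (fun _ _ => hcont _)
      (fun t ht => by simp [hχ0 (Finset.ne_of_mem_erase ht)])]
    conv_lhs => rw [← cfcₙ_id' ℝ a]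
    refine cfcₙ_congr fun x hx => ?_
    by_cases h : x = 0
    · subst h
      simp [χ]
    · simp [χ, Finset.sum_apply, h, hx]

/-- Minimal nonzero projections. -/
def IsMinimalProjection (e : A) : Prop :=
  IsStarProjection e ∧ e ≠ 0 ∧ ∀ q, IsStarProjection q → q * e = q → q = 0 ∨ q = e

lemma mul_eq_of_mul_eq {p q : A} (hp : IsStarProjection p) (hq : IsStarProjection q)
    (h : q * p = q) : p * q = q := by
  have := congrArg star h
  rwa [star_mul, hp.isSelfAdjoint.star_eq, hq.isSelfAdjoint.star_eq] at this

/-- If all spectra are finite, there is a minimal projection below every nonzero projection. -/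
lemma exists_isMinimalProjection_mul_eq
    (hfin : ∀ a : A, IsSelfAdjoint a → (quasispectrum ℝ a).Finite)
    {p : A} (hp : IsStarProjection p) (hp0 : p ≠ 0) :
    ∃ e, IsMinimalProjection e ∧ e * p = e := by
  let r (x y : {q : A // IsStarProjection q}) : Prop := x.1 * y.1 = x.1 ∧ x ≠ y
  -- The successive differences in an infinite strictly descending chain would be nonzero orthogonal
  -- projections.
  have hwf : WellFounded r := by
    rw [wellFounded_iff_isEmpty_descending_chain]
    refine ⟨fun ⟨f, hf⟩ => ?_⟩
    have hle (m k : ℕ) : (f (m + k)).1 * (f m).1 = (f (m + k)).1 := by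
      induction k with
      | zero => exact (f m).2.isIdempotentElem.eq
      | succ k ih =>
        have h1 : (f (m + (k + 1))).1 * (f (m + k)).1 = (f (m + (k + 1))).1 := (hf (m + k)).1
        rw [← h1, mul_assoc, ih]
    have hle' (m k : ℕ) : (f m).1 * (f (m + k)).1 = (f (m + k)).1 :=
      mul_eq_of_mul_eq (f m).2 (f (m + k)).2 (hle m k)
    have key (m n : ℕ) (h : m < n) :
        ((f m).1 - (f (m + 1)).1) * ((f n).1 - (f (n + 1)).1) = 0 := by
      obtain ⟨k, rfl⟩ := Nat.exists_eq_add_of_le h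
      have h1 := hle' m (1 + k)
      have h2 := hle' m (1 + k + 1)
      have h3 := hle' (m + 1) k
      have h4 := hle' (m + 1) (k + 1)
      simp only [← add_assoc] at h1 h2 h3 h4
      simp only [Nat.succ_eq_add_one, sub_mul, mul_sub, h1, h2, h3, h4, sub_self]
    have hproj (n : ℕ) : IsStarProjection ((f n).1 - (f (n + 1)).1) :=
      (f (n + 1)).2.sub_of_mul_eq_left (f n).2 (hf n).1
    obtain ⟨a, ha, hinf⟩ := exists_infinite_quasispectrum_of_orthogonal hproj
      (fun n => sub_ne_zero.2 fun h => (hf n).2 (Subtype.ext h.symm)) (fun m n h => by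
        rcases h.lt_or_gt with h | h
        · exact key m n h
        · have := congrArg star (key n m h)
          rwa [star_mul, (hproj m).isSelfAdjoint.star_eq, (hproj n).isSelfAdjoint.star_eq,
            star_zero] at this)
    exact hinf (hfin a ha)
  obtain ⟨e, ⟨hep, he0⟩, hmin⟩ := hwf.has_min {q | q.1 * p = q.1 ∧ q.1 ≠ 0}
    ⟨⟨p, hp⟩, hp.isIdempotentElem.eq, hp0⟩
  refine ⟨e.1, ⟨e.2, he0, fun q hq hqe => ?_⟩, hep⟩
  by_contra! h
  refine hmin ⟨q, hq⟩ ⟨?_, h.1⟩ ⟨hqe, fun h' => h.2 (congrArg Subtype.val h')⟩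
  change q * p = q
  rw [← hqe, mul_assoc, hep]

/-- If all spectra are finite, a nonzero self-adjoint element has a nonzero projection among its
left multiples. -/
lemma exists_projection_eq_mul
    (hfin : ∀ a : A, IsSelfAdjoint a → (quasispectrum ℝ a).Finite)
    {a : A} (ha : IsSelfAdjoint a) (ha0 : a ≠ 0) :
    ∃ q b, IsStarProjection q ∧ q ≠ 0 ∧ q = b * a := by
  obtain ⟨s, q, hq, hsum⟩ := exists_sum_smul_projection ha (hfin a ha)
  rw [hsum] at ha0
  obtain ⟨t, ht, h0⟩ := Finset.exists_ne_zero_of_sum_ne_zero ha0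
  obtain ⟨hp, b, hb⟩ := hq t ht
  exact ⟨q t, b, hp, fun h => h0 (by rw [h, smul_zero]), hb⟩

/-- The spectral projections of a self-adjoint element of `e A e` lie below `e`, so minimality makes
each of them 0 or `e`. -/
lemma IsMinimalProjection.exists_mul_mul_self_eq_smul
    (hfin : ∀ a : A, IsSelfAdjoint a → (quasispectrum ℝ a).Finite)
    {e : A} (he : IsMinimalProjection e) (x : A) :
    ∃ c : ℂ, e * x * e = c • e := by
  have hsa (y : A) (hy : IsSelfAdjoint y) : ∃ c : ℂ, e * y * e = c • e := by
    have hy' : IsSelfAdjoint (e * y * e) := by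
      simpa [he.1.isSelfAdjoint.star_eq] using hy.conjugate e
    obtain ⟨s, q, hq, hsum⟩ := exists_sum_smul_projection hy' (hfin _ hy')
    have h1 : e * y * e ∈ Submodule.span ℂ {e} := by
      rw [hsum]
      refine Submodule.sum_mem _ fun t ht => ?_
      obtain ⟨hp, b, hb⟩ := hq t ht
      rw [← Complex.coe_smul]
      refine Submodule.smul_mem _ _ ?_
      rcases he.2.2 (q t) hp (by
        rw [hb]; simp only [mul_assoc, he.1.isIdempotentElem.eq]) with h | h
      · rw [h]; exact Submodule.zero_mem _
      · rw [h]; exact Submodule.mem_span_singleton_self e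
    obtain ⟨c, hc⟩ := Submodule.mem_span_singleton.1 h1
    exact ⟨c, hc.symm⟩
  obtain ⟨c, hc⟩ := hsa _ (realPart x).2
  obtain ⟨d, hd⟩ := hsa _ (imaginaryPart x).2
  refine ⟨c + Complex.I * d, ?_⟩
  nth_rw 1 [← realPart_add_I_smul_imaginaryPart x]
  rw [mul_add, add_mul, hc, mul_smul_comm, smul_mul_assoc, hd, smul_smul, add_smul]

/-- Any nonzero `u` in `e A f` spans: `u * star u = c • e` with `c ≠ 0`, while `star u * (e * x * f)
= d • f`, hence `c • (e * x * f) = d • u`. -/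
lemma IsMinimalProjection.exists_mul_mul_eq_smul
    (hfin : ∀ a : A, IsSelfAdjoint a → (quasispectrum ℝ a).Finite)
    {e f : A} (he : IsMinimalProjection e)
    (hf : IsMinimalProjection f) : ∃ u : A, ∀ x, ∃ c : ℂ, e * x * f = c • u := by
  by_cases h : ∃ x₀, e * x₀ * f ≠ 0
  · obtain ⟨x₀, h0⟩ := h
    refine ⟨e * x₀ * f, fun x => ?_⟩
    set u := e * x₀ * f with hu
    have hus : star u = f * star x₀ * e := by
      simp [hu, he.1.isSelfAdjoint.star_eq, hf.1.isSelfAdjoint.star_eq, mul_assoc]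
    obtain ⟨c, hc⟩ := he.exists_mul_mul_self_eq_smul hfin (x₀ * f * f * star x₀)
    obtain ⟨d, hd⟩ := hf.exists_mul_mul_self_eq_smul hfin (star x₀ * e * e * x)
    have hc' : u * star u = c • e := by rw [← hc, hus, hu]; simp only [mul_assoc]
    have hd' : star u * (e * x * f) = d • f := by rw [← hd, hus]; simp only [mul_assoc]
    have hc0 : c ≠ 0 := by
      rintro rfl
      rw [zero_smul, CStarRing.mul_star_self_eq_zero_iff] at hc'
      exact h0 hc'
    refine ⟨c⁻¹ * d, ?_⟩
    have h1 : c • (e * x * f) = d • u := by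
      have e1 : c • (e * x * f) = (c • e) * (e * x * f) := by
        simp only [smul_mul_assoc, ← mul_assoc, he.1.isIdempotentElem.eq]
      rw [e1, ← hc', mul_assoc, hd', mul_smul_comm, hu, mul_assoc, hf.1.isIdempotentElem.eq]
    rw [← smul_smul, ← h1, smul_smul, inv_mul_cancel₀ hc0, one_smul]
  · push Not at h
    exact ⟨0, fun x => ⟨0, by rw [h x, zero_smul]⟩⟩

/-- If all spectra are finite, there is a finite set of minimal projections whose sum is a unit. -/
lemma exists_finset_isMinimalProjection_sum_mul_eq
    (hfin : ∀ a : A, IsSelfAdjoint a → (quasispectrum ℝ a).Finite) :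
    ∃ S : Finset A, (∀ e ∈ S, IsMinimalProjection e) ∧ ∀ x, x * ∑ e ∈ S, e = x := by
  obtain ⟨S, hS⟩ := zorn_subset
    {S : Set A | (∀ e ∈ S, IsMinimalProjection e) ∧ S.Pairwise fun e f => e * f = 0} (by
      intro c hc hchain
      refine ⟨⋃₀ c, ⟨?_, ?_⟩, fun s hs => Set.subset_sUnion_of_mem hs⟩
      · rintro e ⟨s, hs, hes⟩
        exact (hc hs).1 e hes
      · exact (Set.pairwise_sUnion hchain.directedOn).2 fun s hs => (hc hs).2)
  have hSfin : S.Finite := by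
    by_contra hinf
    have : Infinite S := Set.infinite_coe_iff.2 hinf
    let g := Infinite.natEmbedding S
    obtain ⟨a, ha, h⟩ := exists_infinite_quasispectrum_of_orthogonal (e := fun n => (g n : A))
      (fun n => (hS.prop.1 _ (g n).2).1) (fun n => (hS.prop.1 _ (g n).2).2.1)
      fun m n h => hS.prop.2 (g m).2 (g n).2 fun h' => h (g.injective (Subtype.ext h'))
    exact h (hfin a ha)
  refine ⟨hSfin.toFinset, fun e he => hS.prop.1 e (by simpa using he), fun x => ?_⟩
  set p := ∑ e ∈ hSfin.toFinset, e with hp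
  have hpe (e : A) (he : e ∈ S) : p * e = e := by
    rw [hp, Finset.sum_mul, Finset.sum_eq_single e]
    · exact (hS.prop.1 e he).1.isIdempotentElem.eq
    · exact fun f hf hfe => hS.prop.2 (by simpa using hf) he hfe
    · exact fun h => (h (by simpa using he)).elim
  by_contra hx
  -- A minimal projection `f` below a left multiple of `star y * y` is orthogonal to all of `S`.
  -- Maximality then puts `f` in `S`, so `f = f * f = 0`.
  set y := x - x * p with hy
  have hy0 : y ≠ 0 := sub_ne_zero.2 (Ne.symm hx)
  have hye (e : A) (he : e ∈ S) : y * e = 0 := by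
    rw [hy, sub_mul, mul_assoc, hpe e he, sub_self]
  obtain ⟨q, b, hq, hq0, hqb⟩ := exists_projection_eq_mul hfin (IsSelfAdjoint.star_mul_self y)
    (by rwa [Ne, CStarRing.star_mul_self_eq_zero_iff])
  obtain ⟨f, hf, hfq⟩ := exists_isMinimalProjection_mul_eq hfin hq hq0
  have hfe (e : A) (he : e ∈ S) : f * e = 0 := by
    rw [← hfq, hqb]
    simp only [mul_assoc, hye e he, mul_zero]
  have hef (e : A) (he : e ∈ S) : e * f = 0 := by
    have := congrArg star (hfe e he)
    rwa [star_mul, hf.1.isSelfAdjoint.star_eq, (hS.prop.1 e he).1.isSelfAdjoint.star_eq,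
      star_zero] at this
  have hfS : f ∈ S := by
    refine hS.le_of_ge (y := insert f S) ⟨?_, ?_⟩ (Set.subset_insert f S) (Set.mem_insert f S)
    · rintro e (rfl | he)
      exacts [hf, hS.prop.1 e he]
    · exact hS.prop.2.insert fun e he _ => ⟨hfe e he, hef e he⟩
  exact hf.2.1 (by rw [← hf.1.isIdempotentElem.eq, hfe f hfS])

/-- A C*-algebra in which all self-adjoint elements have finite spectrum is finite-dimensional. -/
theorem finiteDimensional_of_finite_quasispectrum
    (hfin : ∀ a : A, IsSelfAdjoint a → (quasispectrum ℝ a).Finite) :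
    FiniteDimensional ℂ A := by
  classical
  obtain ⟨S, hS, hmul⟩ := exists_finset_isMinimalProjection_sum_mul_eq hfin
  have hu (e f : S) : ∃ u : A, ∀ x, ∃ c : ℂ, (e : A) * x * f = c • u :=
    (hS e e.2).exists_mul_mul_eq_smul hfin (hS f f.2)
  choose u hu using hu
  have hmul' (x : A) : (∑ e ∈ S, e) * x = x := by
    have h1 := congrArg star (hmul (star x))
    have h2 : star (∑ e ∈ S, e) = ∑ e ∈ S, e := by
      rw [star_sum]
      exact Finset.sum_congr rfl fun e he => (hS e he).1.isSelfAdjoint.star_eq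
    rwa [star_mul, star_star, h2] at h1
  refine ⟨⟨Finset.univ.image fun i : S × S => u i.1 i.2, ?_⟩⟩
  rw [eq_top_iff]
  intro x _
  -- Expanding `x` on both sides by the unit gives the sum of the corners `e * x * f`.
  rw [← hmul x, ← hmul' x, Finset.sum_mul, Finset.sum_mul]
  refine Submodule.sum_mem _ fun e he => ?_
  rw [Finset.mul_sum]
  refine Submodule.sum_mem _ fun f hf => ?_
  obtain ⟨c, hc⟩ := hu ⟨e, he⟩ ⟨f, hf⟩ x
  rw [show e * x * f = c • u ⟨e, he⟩ ⟨f, hf⟩ from hc]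
  refine Submodule.smul_mem _ _ (Submodule.subset_span ?_)
  simp only [Finset.coe_image, Finset.coe_univ, Set.image_univ]
  exact ⟨(⟨e, he⟩, ⟨f, hf⟩), rfl⟩

end CStarUltrapower

open CStarUltrapower in
theorem mainTheorem7 {A : Type*} [NonUnitalCStarAlgebra A] (hA : ¬ FiniteDimensional ℂ A)
    (U : Ultrafilter ℕ) (hU : ∀ n : ℕ, U ≠ pure n) :
    ∃ φ : StrongDual ℂ (Ultrapower U A), IsState φ ∧
      ¬ ∃ ψ : ℕ → StrongDual ℂ A, (∀ n, IsState (ψ n)) ∧ IsUltralimit U ψ φ := by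
  obtain ⟨a, ha, hinf⟩ : ∃ a : A, IsSelfAdjoint a ∧ (quasispectrum ℝ a).Infinite := by
    by_contra! h
    exact hA (finiteDimensional_of_finite_quasispectrum h)
  have hU' : (U : Filter ℕ) ≤ atTop := by
    rw [← Nat.cofinite_eq_atTop]
    exact (Ultrafilter.le_cofinite_or_eq_pure U).resolve_right fun ⟨n, hn⟩ => hU n hn
  obtain ⟨h, P, hpos, hn, hP, h1, h0⟩ := exists_functionals_double_limit ha hinf
  obtain ⟨φ, hφ, hnot⟩ := exists_isState_not_isUltralimit hU' h hpos hn P hP h1 h0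
  exact ⟨φ, hφ, fun ⟨ψ, _, hψ⟩ => hnot ψ hψ⟩
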